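/- Let $K$ be a number field with an algebraic closure $\overline K$, let $v$ be a finite place of $K$ with valuation ring $O_v$ and residue field $k(v)$, and fix an extension of $v$ to $\overline K$, with residue field $\overline{k(v)}$. A point of $\mathbb P^1(\overline K)$ is reduced modulo $v$ by writing it as $[a:b]$ with $a,b$ integral for the extended valuation and at least one of them a unit, and reducing the coordinates; for $E\subset\mathbb P^1(\overline K)$ let $(E)_v\subset\mathbb P^1(\overline{k(v)})$ be the set of the reductions of its points. Let $\Phi:\mathbb P^1\to\mathbb P^1$ be a morphism of degree $d\ge 2$ defined over $K$, and write $\Phi=[F:G]$ with $F,G\in O_v[X,Y]$ homogeneous of degree $d$, coprime over $K$, at least one of their coefficients being a unit of $O_v$. Let $\Phi_v:\mathbb P^1_{k(v)}\to\mathbb P^1_{k(v)}$ be the morphism defined by $[F_v:G_v]$, where $F_v,G_v$ are obtained by reducing the coefficients and common factors of $F_v$ and $G_v$ are cancelled. Let $\mathcal R_\Phi\subset\mathbb P^1(\overline K)$ be the set of ramification points of $\Phi$ (the points with ramification index at least $2$), so that $\Phi(\mathcal R_\Phi)$ is the set of branch points. Suppose that $\Phi_v$ is separable, i.e. that it is non-constant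 and the extension of function fields $k(v)(x)/k(v)(\Phi_v)$ is separable. Then the following are equivalent: a) $\Phi$ has critically good reduction at $v$, i.e. $\#\mathcal R_\Phi=\#(\mathcal R_\Phi)_v$ and $\#\Phi(\mathcal R_\Phi)=\#(\Phi(\mathcal R_\Phi))_v$; b) $\Phi$ has simple good reduction at $v$, i.e. $\deg\Phi_v=\deg\Phi$, and $\#\Phi(\mathcal R_\Phi)=\#(\Phi(\mathcal R_\Phi))_v$. -/

import Mathlib

open scoped NumberField IntermediateField

noncomputable section

namespace ProjLine

/-- The points `ℙ¹(k)` of the projective line over a field `k`. -/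
abbrev Pt (k : Type*) [Field k] : Type _ := Projectivization k (Fin 2 → k)

/-- Morphisms `ℙ¹ → ℙ¹` over `k`, given by their rational function in the coordinate
`x = X / Y`: a rational function `φ ∈ k(x)`, or the constant map `∞`. -/
abbrev Mor (k : Type*) [Field k] : Type _ := OnePoint (RatFunc k)

section Morphisms

variable {k : Type*} [Field k]

/-- The numerator `f` in lowest terms (`Φ = f / g`; the constant map `∞` is `1 / 0`). -/
def Mor.num (Φ : Mor k) : Polynomial k := OnePoint.elim Φ 1 RatFunc.num

/-- The denominator `g` in lowest terms (`Φ = f / g`; the constant map `∞` is `1 / 0`). -/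
def Mor.den (Φ : Mor k) : Polynomial k := OnePoint.elim Φ 0 RatFunc.denom

/-- The degree `max (deg f) (deg g)` of a morphism `Φ = f / g` in lowest terms. -/
def Mor.deg (Φ : Mor k) : ℕ := max (Mor.num Φ).natDegree (Mor.den Φ).natDegree

/-- `F(X, Y) = Y ^ d f(X / Y)`, where `d = deg Φ`, so that `Φ = [F : G]`. -/
def Mor.formF (Φ : Mor k) : MvPolynomial (Fin 2) k := (Mor.num Φ).homogenize (Mor.deg Φ)

/-- `G(X, Y) = Y ^ d g(X / Y)`, where `d = deg Φ`, so that `Φ = [F : G]`. -/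
def Mor.formG (Φ : Mor k) : MvPolynomial (Fin 2) k := (Mor.den Φ).homogenize (Mor.deg Φ)

theorem Mor.isCoprime (Φ : Mor k) : IsCoprime (Mor.num Φ) (Mor.den Φ) := by
  induction Φ using OnePoint.rec with
  | infty => exact isCoprime_one_left
  | coe φ => exact RatFunc.isCoprime_num_denom φ

theorem coeff_eq_zero_of_homogenize {L : Type*} [Field L] [Algebra k L] (f : Polynomial k) (d : ℕ)
    (p : Fin 2 → L) (hp : p 1 = 0) (h0 : p 0 ≠ 0)
    (h : MvPolynomial.aeval p (f.homogenize d) = 0) : f.coeff d = 0 := by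
  rw [Polynomial.homogenize, map_sum, Finset.sum_eq_single (d, 0)] at h
  · simpa [MvPolynomial.aeval_monomial, Finsupp.update_eq_add_single, Finsupp.prod_add_index',
      pow_add, h0] using h
  · rintro ⟨a, b⟩ hab hne
    have hb : b ≠ 0 := by
      rintro rfl
      simp at hab
      simp [hab] at hne
    simp [MvPolynomial.aeval_monomial, Finsupp.update_eq_add_single, Finsupp.prod_add_index',
      pow_add, hp, hb]
  · simp

theorem aeval_eq_zero_of_homogenize {L : Type*} [Field L] [Algebra k L] (f : Polynomial k) (d : ℕ)
    (hd : f.natDegree ≤ d) (p : Fin 2 → L) (hp : p 1 ≠ 0)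
    (h : MvPolynomial.aeval p (f.homogenize d) = 0) :
    Polynomial.aeval (p 0 / p 1) f = 0 := by
  have key := Polynomial.eval_homogenize (p := f.map (algebraMap k L)) (n := d)
    (by simpa using hd) p hp
  rw [Polynomial.homogenize_map, MvPolynomial.eval_map, ← MvPolynomial.aeval_def, h,
    Polynomial.eval_map, ← Polynomial.aeval_def] at key
  have := pow_ne_zero d hp
  simpa [this] using key.symm

theorem Mor.forms_ne_zero {L : Type*} [Field L] [Algebra k L] (Φ : Mor k) (p : Fin 2 → L)
    (hp : p ≠ 0) :
    (![MvPolynomial.aeval p (Mor.formF Φ), MvPolynomial.aeval p (Mor.formG Φ)] : Fin 2 → L)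
      ≠ 0 := by
  intro h
  have hF : MvPolynomial.aeval p (Mor.formF Φ) = 0 := congrFun h 0
  have hG : MvPolynomial.aeval p (Mor.formG Φ) = 0 := congrFun h 1
  by_cases h1 : p 1 = 0
  · have h0 : p 0 ≠ 0 := fun h0 => hp (by ext i; fin_cases i <;> simp [h0, h1])
    have hf := coeff_eq_zero_of_homogenize _ _ p h1 h0 hF
    have hg := coeff_eq_zero_of_homogenize _ _ p h1 h0 hG
    have hcop := Mor.isCoprime Φ
    rcases max_choice (Mor.num Φ).natDegree (Mor.den Φ).natDegree with hm | hm
    · have hz : Mor.num Φ = 0 := by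
        rw [Mor.deg, hm] at hf
        simpa using hf
      have hu : IsUnit (Mor.den Φ) := by rwa [hz, isCoprime_zero_left] at hcop
      rw [Mor.deg, hm, hz, Polynomial.natDegree_zero] at hg
      rw [Polynomial.eq_C_of_natDegree_eq_zero (Polynomial.natDegree_eq_zero_of_isUnit hu), hg]
        at hu
      simp at hu
    · have hz : Mor.den Φ = 0 := by
        rw [Mor.deg, hm] at hg
        simpa using hg
      have hu : IsUnit (Mor.num Φ) := by rwa [hz, isCoprime_zero_right] at hcop
      rw [Mor.deg, hm, hz, Polynomial.natDegree_zero] at hf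
      rw [Polynomial.eq_C_of_natDegree_eq_zero (Polynomial.natDegree_eq_zero_of_isUnit hu), hf]
        at hu
      simp at hu
  · have hf := aeval_eq_zero_of_homogenize _ _ (le_max_left _ _) p h1 hF
    have hg := aeval_eq_zero_of_homogenize _ _ (le_max_right _ _) p h1 hG
    obtain ⟨a, b, hab⟩ := Mor.isCoprime Φ
    have := congrArg (Polynomial.aeval (p 0 / p 1)) hab
    simp [hf, hg] at this

/-- The map `[p₀ : p₁] ↦ [F(p₀, p₁) : G(p₀, p₁)]` on `L`-points, for an extension `L / k`. -/
def Mor.map {L : Type*} [Field L] [Algebra k L] (Φ : Mor k) (P : Pt L) : Pt L :=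
  Projectivization.mk L _ (Mor.forms_ne_zero Φ P.rep P.rep_nonzero)

/-- The ramification index `e_P(Φ)` at an `L`-point `P = [p₀ : p₁]`: the multiplicity of the
linear form `p₁ X - p₀ Y`, which defines `P`, in the form `G(P) F - F(P) G`, which defines the
fibre of `Φ` through `P`. -/
def Mor.ramificationIdx {L : Type*} [Field L] [Algebra k L] (Φ : Mor k) (P : Pt L) : ℕ∞ :=
  emultiplicity
    (MvPolynomial.C (P.rep 1) * MvPolynomial.X 0 - MvPolynomial.C (P.rep 0) * MvPolynomial.X 1)
    (MvPolynomial.C (MvPolynomial.aeval P.rep (Mor.formG Φ)) *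
        MvPolynomial.map (algebraMap k L) (Mor.formF Φ) -
      MvPolynomial.C (MvPolynomial.aeval P.rep (Mor.formF Φ)) *
        MvPolynomial.map (algebraMap k L) (Mor.formG Φ))

/-- The set `R_Φ` of ramification points of `Φ` among the `L`-points of the line. -/
def Mor.ramificationSet (L : Type*) [Field L] [Algebra k L] (Φ : Mor k) : Set (Pt L) :=
  {P | 1 < Mor.ramificationIdx Φ P}

/-- The set `Φ(R_Φ)` of branch points. -/
def Mor.branchSet (L : Type*) [Field L] [Algebra k L] (Φ : Mor k) : Set (Pt L) :=
  Mor.map Φ '' Mor.ramificationSet L Φ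

/-- `Φ` is separable: the extension of function fields `k(x) / k(Φ)` is (algebraic and)
separable. A constant map is not separable. -/
def Mor.IsSeparable (Φ : Mor k) : Prop :=
  OnePoint.elim Φ False (fun φ => Algebra.IsSeparable k⟮φ⟯ (RatFunc k))

end Morphisms

section Reduction

variable {L : Type*} [Field L] (A : ValuationSubring L)

/-- A finite family in `L` that is not identically zero can be rescaled so that all members are
in `A` and one of them is a unit of `A`. -/
theorem exists_primitive {ι : Type*} (s : Finset ι) (x : ι → L) (hx : ∃ i ∈ s, x i ≠ 0) :
    ∃ c : L, c ≠ 0 ∧ (∀ i ∈ s, c * x i ∈ A) ∧ ∃ i ∈ s, A.valuation (c * x i) = 1 := by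
  obtain ⟨j, hj, hxj⟩ := hx
  obtain ⟨i, hi, hmax⟩ := s.exists_max_image (fun i => A.valuation (x i)) ⟨j, hj⟩
  have hi0 : x i ≠ 0 := by
    intro h
    have := hmax j hj
    simp [h, hxj] at this
  refine ⟨(x i)⁻¹, inv_ne_zero hi0, fun l hl => ?_, i, hi, by simp [hi0]⟩
  rw [← A.valuation_le_one_iff, map_mul, map_inv₀]
  have hv : A.valuation (x i) ≠ 0 := by simpa using hi0
  exact (mul_le_mul_right (hmax l hl) _).trans (by rw [inv_mul_cancel₀ hv])

/-- Every point of `ℙ¹(L)` has coordinates in `A`, at least one of which is a unit. -/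
theorem exists_primitive_coords (P : Pt L) :
    ∃ a : Fin 2 → A, (∃ i, IsUnit (a i)) ∧
      ∃ h : (fun i => (a i : L)) ≠ 0, Projectivization.mk L (fun i => (a i : L)) h = P := by
  obtain ⟨c, hc, hA, i, -, hi⟩ := exists_primitive A Finset.univ P.rep
    (by simpa [Function.ne_iff] using Function.ne_iff.mp P.rep_nonzero)
  refine ⟨fun i => ⟨c * P.rep i, hA i (Finset.mem_univ i)⟩, ⟨i, ?_⟩, ?_, ?_⟩
  · exact (A.valuation_eq_one_iff _).mpr hi
  · intro h
    have := congrFun h i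
    simp only [Pi.zero_apply] at this
    simp [this] at hi
  · conv_rhs => rw [← P.mk_rep]
    rw [Projectivization.mk_eq_mk_iff']
    exact ⟨c, rfl⟩

theorem residue_ne_zero {a : Fin 2 → A} (h : ∃ i, IsUnit (a i)) :
    (fun i => IsLocalRing.residue A (a i)) ≠ 0 := by
  obtain ⟨i, hi⟩ := h
  exact fun h0 => (hi.map (IsLocalRing.residue A)).ne_zero (congrFun h0 i)

/-- Reduction of points `ℙ¹(L) → ℙ¹(κ)`, where `κ` is the residue field of `A`: write the point
with coordinates in `A`, one of them a unit, and reduce the coordinates. -/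
def reducePt (P : Pt L) : Pt (IsLocalRing.ResidueField A) :=
  Projectivization.mk _ _ (residue_ne_zero A (exists_primitive_coords A P).choose_spec.1)

/-- Two systems of coordinates in `A` with a unit among them reduce to the same point. -/
theorem mk_residue_eq {a b : Fin 2 → A} (ha : ∃ i, IsUnit (a i)) (hb : ∃ i, IsUnit (b i))
    (h : (fun i => (a i : L)) ≠ 0) (h' : (fun i => (b i : L)) ≠ 0)
    (hab : Projectivization.mk L (fun i => (b i : L)) h' =
      Projectivization.mk L (fun i => (a i : L)) h) :
    Projectivization.mk (IsLocalRing.ResidueField A) _ (residue_ne_zero A hb) =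
      Projectivization.mk _ _ (residue_ne_zero A ha) := by
  rw [Projectivization.mk_eq_mk_iff'] at hab ⊢
  obtain ⟨c, hc⟩ := hab
  have hc' : ∀ i, c * (a i : L) = b i := fun i => congrFun hc i
  have hcA : c ∈ A := by
    obtain ⟨i, u, hu⟩ := ha
    have : c = ((b i * (↑u⁻¹ : A) : A) : L) := by
      have h1 : ((u : A) : L) * ((↑u⁻¹ : A) : L) = 1 := by
        exact_mod_cast congrArg (Subtype.val) u.mul_inv
      push_cast
      rw [← hc' i, ← hu, mul_assoc, h1, mul_one]
    rw [this]
    exact Subtype.property _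
  refine ⟨IsLocalRing.residue A ⟨c, hcA⟩, funext fun i => ?_⟩
  simp only [Pi.smul_apply, smul_eq_mul, ← map_mul]
  exact congrArg _ (Subtype.ext (hc' i))

/-- The reduction of a point does not depend on the choice of the coordinates. -/
theorem reducePt_mk (a : Fin 2 → A) (ha : ∃ i, IsUnit (a i)) (h : (fun i => (a i : L)) ≠ 0) :
    reducePt A (Projectivization.mk L (fun i => (a i : L)) h) =
      Projectivization.mk _ _ (residue_ne_zero A ha) := by
  obtain ⟨hb, hb0, hbe⟩ :=
    (exists_primitive_coords A (Projectivization.mk L (fun i => (a i : L)) h)).choose_spec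
  exact mk_residue_eq A ha hb h hb0 hbe

/-- `f / g` is a reduced form of `Φ`: `f` and `g` have coefficients in `A`, not all of them
non-units, and are obtained from the numerator and the denominator of `Φ` by a common
nonzero factor. -/
structure IsReducedForm (Φ : Mor L) (f g : Polynomial A) : Prop where
  exists_scalar : ∃ c : L, c ≠ 0 ∧
    f.map (algebraMap A L) = Polynomial.C c * Mor.num Φ ∧
    g.map (algebraMap A L) = Polynomial.C c * Mor.den Φ
  primitive : ∃ i, IsUnit (f.coeff i) ∨ IsUnit (g.coeff i)

theorem exists_isReducedForm (Φ : Mor L) :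
    ∃ fg : Polynomial A × Polynomial A, IsReducedForm A Φ fg.1 fg.2 := by
  have hne : ∃ i ∈ (Finset.range (Mor.deg Φ + 1)).disjSum (Finset.range (Mor.deg Φ + 1)),
      Sum.elim (Mor.num Φ).coeff (Mor.den Φ).coeff i ≠ 0 := by
    by_contra! hcon
    have hf : Mor.num Φ = 0 := by
      ext i
      by_cases hi : i < Mor.deg Φ + 1
      · exact hcon (Sum.inl i) (by simpa using hi)
      · exact Polynomial.coeff_eq_zero_of_natDegree_lt
          (lt_of_le_of_lt (le_max_left _ _) (not_lt.mp hi))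
    have hg : Mor.den Φ = 0 := by
      ext i
      by_cases hi : i < Mor.deg Φ + 1
      · exact hcon (Sum.inr i) (by simpa using hi)
      · exact Polynomial.coeff_eq_zero_of_natDegree_lt
          (lt_of_le_of_lt (le_max_right _ _) (not_lt.mp hi))
    have := Mor.isCoprime Φ
    rw [hf, hg, isCoprime_zero_left] at this
    exact not_isUnit_zero this
  obtain ⟨c, hc, hA, i, hi, hu⟩ := exists_primitive A _ _ hne
  have lift : ∀ q : Polynomial L, (∀ j, c * q.coeff j ∈ A) →
      ∃ r : Polynomial A, r.map (algebraMap A L) = Polynomial.C c * q := by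
    intro q hq
    have : Polynomial.C c * q ∈ Polynomial.lifts (algebraMap A L) := by
      rw [Polynomial.lifts_iff_coeff_lifts]
      intro j
      exact ⟨⟨c * q.coeff j, hq j⟩, by rw [Polynomial.coeff_C_mul]; rfl⟩
    exact (Polynomial.mem_lifts _).mp this
  have hAf : ∀ j, c * (Mor.num Φ).coeff j ∈ A := by
    intro j
    by_cases hj : j < Mor.deg Φ + 1
    · exact hA (Sum.inl j) (by simpa using hj)
    · rw [Polynomial.coeff_eq_zero_of_natDegree_lt
        (lt_of_le_of_lt (le_max_left _ _) (not_lt.mp hj)), mul_zero]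
      exact A.zero_mem
  have hAg : ∀ j, c * (Mor.den Φ).coeff j ∈ A := by
    intro j
    by_cases hj : j < Mor.deg Φ + 1
    · exact hA (Sum.inr j) (by simpa using hj)
    · rw [Polynomial.coeff_eq_zero_of_natDegree_lt
        (lt_of_le_of_lt (le_max_right _ _) (not_lt.mp hj)), mul_zero]
      exact A.zero_mem
  obtain ⟨f, hf⟩ := lift _ hAf
  obtain ⟨g, hg⟩ := lift _ hAg
  refine ⟨(f, g), ⟨c, hc, hf, hg⟩, ?_⟩
  rcases i with i | i
  · refine ⟨i, Or.inl ((A.valuation_eq_one_iff _).mpr ?_)⟩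
    have := congrArg (fun q => Polynomial.coeff q i) hf
    simp only [Polynomial.coeff_map, Polynomial.coeff_C_mul] at this
    exact (congrArg A.valuation this).trans hu
  · refine ⟨i, Or.inr ((A.valuation_eq_one_iff _).mpr ?_)⟩
    have := congrArg (fun q => Polynomial.coeff q i) hg
    simp only [Polynomial.coeff_map, Polynomial.coeff_C_mul] at this
    exact (congrArg A.valuation this).trans hu

open Classical in
/-- The morphism `f / g` for polynomials `f`, `g` over a field that are not both zero. -/
def Mor.ofPair {k : Type*} [Field k] (f g : Polynomial k) : Mor k :=
  if g = 0 then OnePoint.infty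
  else OnePoint.some (algebraMap (Polynomial k) (RatFunc k) f / algebraMap _ _ g)

/-- The reduced morphism `Φ_v = f_v / g_v` over the residue field, where `f / g` is a reduced
form of `Φ` (which is unique up to a common factor that is a unit of `A`). Common factors of
`f_v` and `g_v` cancel. -/
def Mor.reduce (Φ : Mor L) : Mor (IsLocalRing.ResidueField A) :=
  Mor.ofPair ((exists_isReducedForm A Φ).choose.1.map (IsLocalRing.residue A))
    ((exists_isReducedForm A Φ).choose.2.map (IsLocalRing.residue A))

/-- Simple good reduction: the reduced morphism has the same degree. -/
def Mor.SimpleGoodReduction (Φ : Mor L) : Prop := Mor.deg (Mor.reduce A Φ) = Mor.deg Φ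

/-- The cardinality of a set of points is preserved by reduction. -/
def NonsingularMod (E : Set (Pt L)) : Prop := E.encard = (reducePt A '' E).encard

end Reduction

/-- Critically good reduction of a morphism over `K`, with respect to a valuation ring `w` of an
algebraic closure of `K`. -/
def Mor.CriticallyGoodReduction {K Kbar : Type*} [Field K] [Field Kbar] [Algebra K Kbar]
    (w : ValuationSubring Kbar) (Φ : Mor K) : Prop :=
  NonsingularMod w (Mor.ramificationSet Kbar Φ) ∧ NonsingularMod w (Mor.branchSet Kbar Φ)

/-- The valuation ring `O_v` of a number field `K` at a finite place `v`. -/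
def valuationRing {K : Type*} [Field K] [NumberField K]
    (v : IsDedekindDomain.HeightOneSpectrum (𝓞 K)) : ValuationSubring K :=
  (v.valuation K).valuationSubring

end ProjLine

end

/-!
In an affine chart with `Φ = f / g`, a point `t` is ramified with index `e` if and only if it is a
root of multiplicity `e - 1 ≥ 1` of the Wronskian `W` of `f` and `g`. Separability of the reduction
says that `W` does not reduce to `0`, so that the order of the reduction of `W` at `α` is the sum
of the `e - 1` over the ramification points in the residue disc of `α`.

Suppose that these points have the same image `a` (and exchange `f` and `g` if it is not integral).
Then `f - a g` vanishes to order `e` at each of them, so its reduction vanishes at `α` to order at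
least the sum of the `e`. In any characteristic the order of a polynomial exceeds that of its
nonzero Wronskian with `g` by at most `1`, and not at all at a root of `g`, while replacing `f` by
`f - a g` does not change `W`. So the disc contains at most one ramification point, and `α` is not
a common root of the reductions of `f` and `g`; if the disc contains no ramification point, this
last claim holds because a common root would be a root of the reduction of `W`, which lifts.

The images agree if reduction is injective on the ramification points, for trivial reasons, and
also if it is injective on the branch points and the reduced forms have no common zero, since `Φ`
then commutes with reduction.
-/

noncomputable section

namespace ProjLine

open Polynomial IsLocalRing

section Wronskian

variable {R : Type*} [CommRing R]

theorem wronskian_map {S : Type*} [CommRing S] (φ : R →+* S) (f g : R[X]) :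
    (wronskian f g).map φ = wronskian (f.map φ) (g.map φ) := by
  simp only [wronskian, Polynomial.map_sub, Polynomial.map_mul, derivative_map]

theorem wronskian_sub_C_mul_left (f g : R[X]) (a : R) :
    wronskian (f - C a * g) g = wronskian f g := by
  simp only [wronskian, derivative_sub, derivative_C_mul]
  ring

theorem wronskian_mul_mul_left (h f g : R[X]) :
    wronskian (h * f) (h * g) = h ^ 2 * wronskian f g := by
  simp only [wronskian, derivative_mul]
  ring

theorem wronskian_X_sub_C_pow_succ_mul (t : R) (n : ℕ) (u g : R[X]) :
    wronskian ((X - C t) ^ (n + 1) * u) g =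
      (X - C t) ^ n * ((X - C t) * wronskian u g - (n + 1 : R[X]) * u * g) := by
  simp only [wronskian, derivative_mul, derivative_X_sub_C_pow, Nat.add_sub_cancel, Nat.cast_add,
    Nat.cast_one, map_add, map_natCast, map_one]
  ring

theorem rootMultiplicity_le_wronskian_add_one {f g : R[X]} (hW : wronskian f g ≠ 0) (t : R) :
    f.rootMultiplicity t ≤ (wronskian f g).rootMultiplicity t + 1 := by
  obtain ⟨u, hu⟩ := f.pow_rootMultiplicity_dvd t
  cases hn : f.rootMultiplicity t with
  | zero => exact Nat.zero_le _
  | succ n =>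
    rw [Nat.add_le_add_iff_right, le_rootMultiplicity_iff hW, hu, hn,
      wronskian_X_sub_C_pow_succ_mul]
    exact dvd_mul_right _ _

theorem rootMultiplicity_le_wronskian {f g : R[X]} (hW : wronskian f g ≠ 0) {t : R}
    (hg : g.IsRoot t) : f.rootMultiplicity t ≤ (wronskian f g).rootMultiplicity t := by
  obtain ⟨u, hu⟩ := f.pow_rootMultiplicity_dvd t
  obtain ⟨v, hv⟩ := dvd_iff_isRoot.mpr hg
  cases hn : f.rootMultiplicity t with
  | zero => exact Nat.zero_le _
  | succ n =>
    rw [le_rootMultiplicity_iff hW, hu, hn, wronskian_X_sub_C_pow_succ_mul, pow_succ]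
    refine mul_dvd_mul_left _ (dvd_sub (dvd_mul_right _ _) (Dvd.dvd.mul_left ?_ _))
    exact hv ▸ dvd_mul_right _ _

theorem rootMultiplicity_wronskian_add_one [IsDomain R] [CharZero R] {f g : R[X]} (hf0 : f ≠ 0)
    {t : R} (hf : f.IsRoot t) (hg : ¬g.IsRoot t) :
    (wronskian f g).rootMultiplicity t + 1 = f.rootMultiplicity t := by
  obtain ⟨u, hu, hdvd⟩ := f.exists_eq_pow_rootMultiplicity_mul_and_not_dvd hf0 t
  obtain ⟨n, hn⟩ := Nat.exists_eq_succ_of_ne_zero ((rootMultiplicity_pos hf0).mpr hf).ne'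
  have hcofactor : ¬((X - C t) * wronskian u g - (n + 1 : R[X]) * u * g).IsRoot t := by
    rw [dvd_iff_isRoot] at hdvd
    have hn1 : (n : R) + 1 ≠ 0 := n.cast_add_one_ne_zero
    simpa [hn1] using And.intro hdvd hg
  have hcofactor0 : (X - C t) * wronskian u g - (n + 1 : R[X]) * u * g ≠ 0 := by
    intro h
    exact hcofactor (by rw [h]; exact eval_zero)
  rw [hn, hu, hn, wronskian_X_sub_C_pow_succ_mul, mul_comm,
    rootMultiplicity_mul_X_sub_C_pow hcofactor0, rootMultiplicity_eq_zero hcofactor, zero_add]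

theorem X_sub_C_sq_dvd_fiber_iff (f g : R[X]) (x : R) :
    (X - C x) ^ 2 ∣ C (g.eval x) * f - C (f.eval x) * g ↔ (wronskian f g).IsRoot x := by
  set H := C (g.eval x) * f - C (f.eval x) * g with hH
  have hH0 : (taylor x H).coeff 0 = 0 := by simp [hH, mul_comm]
  have hH1 : (taylor x H).coeff 1 = -(wronskian f g).eval x := by simp [hH, wronskian, mul_comm]
  rw [X_sub_C_pow_dvd_iff, ← taylor_apply, X_pow_dvd_iff, IsRoot, ← neg_eq_zero, ← hH1]
  refine ⟨fun h => h 1 one_lt_two, fun h i hi => ?_⟩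
  interval_cases i
  exacts [hH0, h]

end Wronskian

section ResidueRoots

variable {L : Type*} [Field L] {A : ValuationSubring L}

theorem exists_map_eq_prod_one_sub_of_nonunits (s : Multiset L) (hs : ∀ b ∈ s, b ∈ A.nonunits) :
    ∃ p : A[X], p.map (algebraMap A L) = (s.map fun b => 1 - C b * X).prod ∧
      p.map (residue A) = 1 := by
  induction s using Multiset.induction_on with
  | empty => exact ⟨1, by simp⟩
  | cons b s ih =>
    obtain ⟨p, hpL, hpk⟩ := ih fun c hc => hs c (Multiset.mem_cons_of_mem hc)
    obtain ⟨hbA, hb⟩ := ValuationSubring.mem_nonunits_iff_exists_mem_maximalIdeal.mp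
      (hs b (Multiset.mem_cons_self b s))
    have hres : residue A ⟨b, hbA⟩ = 0 := (residue_eq_zero_iff _).mpr hb
    refine ⟨(1 - C ⟨b, hbA⟩ * X) * p, ?_, ?_⟩
    · simp [hpL]
    · simp [hpk, hres]

theorem eq_C_coeff_zero_mul_prod_one_sub {k : Type*} [Field k] {p : k[X]} (hp : p.Splits)
    (h0 : p.coeff 0 ≠ 0) :
    p = C (p.coeff 0) * ((p.roots.map (·⁻¹)).map fun b => 1 - C b * X).prod := by
  have hprod : (p.roots.map fun x => X - C x).prod =
      C (p.roots.map Neg.neg).prod * ((p.roots.map (·⁻¹)).map fun b => 1 - C b * X).prod := by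
    rw [map_multiset_prod, Multiset.map_map, Multiset.map_map, ← Multiset.prod_map_mul]
    refine congrArg _ (Multiset.map_congr rfl fun x hx => ?_)
    have hx0 : x ≠ 0 := by
      rintro rfl
      exact h0 (coeff_zero_eq_eval_zero p ▸ isRoot_of_mem_roots hx)
    have : C x * C x⁻¹ = 1 := by rw [← C_mul, mul_inv_cancel₀ hx0, C_1]
    simp only [Function.comp_apply, C_neg]
    linear_combination -X * this
  have hfactor : p = C (p.leadingCoeff * (p.roots.map Neg.neg).prod) *
      ((p.roots.map (·⁻¹)).map fun b => 1 - C b * X).prod := by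
    rw [C_mul, mul_assoc, ← hprod]
    exact hp.eq_prod_roots
  have hcoeff : p.coeff 0 = p.leadingCoeff * (p.roots.map Neg.neg).prod := by
    conv_lhs => rw [hfactor, coeff_zero_eq_eval_zero]
    simp [eval_multiset_prod]
  rw [hcoeff]
  exact hfactor

variable [IsAlgClosed L]

instance isAlgClosed_residueField (A : ValuationSubring L) : IsAlgClosed (ResidueField A) := by
  refine IsAlgClosed.of_exists_root _ fun p hp hirr => ?_
  obtain ⟨q, rfl, -, hq⟩ := lifts_and_natDegree_eq_and_monic
    ((lifts_iff_coeff_lifts p).mpr fun _ => residue_surjective _) hp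
  have hdeg : (q.map (algebraMap A L)).degree ≠ 0 := by
    rw [hq.degree_map, ← hq.degree_map (residue A)]
    exact hirr.degree_pos.ne'
  obtain ⟨x, hx⟩ := IsAlgClosed.exists_root _ hdeg
  obtain ⟨a, rfl⟩ := IsIntegrallyClosed.isIntegral_iff.mp
    (⟨q, hq, by rwa [IsRoot, eval_map] at hx⟩ : IsIntegral A x)
  exact ⟨residue A a, (hx.of_map (FaithfulSMul.algebraMap_injective A L)).map⟩

theorem map_residue_eq_C_of_roots_eq_zero {q : A[X]} (hq : q.roots = 0) :
    q.map (residue A) = C (residue A (q.coeff 0)) := by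
  obtain rfl | hq0 := eq_or_ne q 0
  · simp
  have hinj := FaithfulSMul.algebraMap_injective A L
  have hroot : ∀ a, ¬q.IsRoot a := fun a ha => by simpa [hq] using (mem_roots hq0).mpr ha
  have hcoeff : (q.map (algebraMap A L)).coeff 0 ≠ 0 := by
    rw [coeff_map, map_ne_zero_iff _ hinj, coeff_zero_eq_eval_zero]
    exact hroot 0
  have hinv : ∀ b ∈ (q.map (algebraMap A L)).roots.map (·⁻¹), b ∈ A.nonunits := by
    simp only [Multiset.mem_map]
    rintro _ ⟨x, hx, rfl⟩
    refine A.inv_mem_nonunits_iff.mpr (Or.inr fun hxA => hroot ⟨x, hxA⟩ ?_)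
    exact IsRoot.of_map (x := (⟨x, hxA⟩ : A)) (isRoot_of_mem_roots hx) hinj
  obtain ⟨p, hpL, hpk⟩ := exists_map_eq_prod_one_sub_of_nonunits _ hinv
  have hqp : q = C (q.coeff 0) * p := by
    apply map_injective _ hinj
    rw [Polynomial.map_mul, hpL, map_C, ← coeff_map]
    exact eq_C_coeff_zero_mul_prod_one_sub (IsAlgClosed.splits _) hcoeff
  conv_lhs => rw [hqp, Polynomial.map_mul, hpk, mul_one, map_C]

theorem roots_map_residue {p : A[X]} (hp : p.map (residue A) ≠ 0) :
    (p.map (residue A)).roots = p.roots.map (residue A) := by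
  obtain ⟨q, hpq, -, hq⟩ := p.exists_prod_multiset_X_sub_C_mul
  have hmap : p.map (residue A) =
      ((p.roots.map (residue A)).map fun a => X - C a).prod * C (residue A (q.coeff 0)) := by
    conv_lhs => rw [← hpq]
    simp [map_residue_eq_C_of_roots_eq_zero hq, Polynomial.map_multiset_prod]
  rw [hmap] at hp ⊢
  rw [roots_mul hp, roots_multiset_prod_X_sub_C, roots_C, add_zero]

open scoped Classical in
theorem rootMultiplicity_map_residue {p : A[X]} (hp : p.map (residue A) ≠ 0)
    (α : ResidueField A) : (p.map (residue A)).rootMultiplicity α =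
      (p.roots.filter fun a => α = residue A a).card := by
  rw [← count_roots, roots_map_residue hp, Multiset.count_map]

theorem exists_isRoot_of_isRoot_map_residue {p : A[X]} (hp : p.map (residue A) ≠ 0)
    {α : ResidueField A} (hα : (p.map (residue A)).IsRoot α) :
    ∃ a, residue A a = α ∧ p.IsRoot a := by
  rw [← mem_roots hp, roots_map_residue hp, Multiset.mem_map] at hα
  obtain ⟨a, ha, rfl⟩ := hα
  exact ⟨a, rfl, isRoot_of_mem_roots ha⟩

end ResidueRoots

section ResidueDisc

variable {L : Type*} [Field L] {A : ValuationSubring L}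

/-- The ramification points of the function `f / g` in the residue disc of `α`. -/
def discRamification (f g : A[X]) (α : ResidueField A) : Set A :=
  {t | residue A t = α ∧ (wronskian f g).IsRoot t}

variable {f g : A[X]} {α : ResidueField A}

theorem discRamification_comm : discRamification f g α = discRamification g f α := by
  simp only [discRamification, ← wronskian_neg_eq f g, IsRoot, eval_neg, neg_eq_zero]

variable [IsAlgClosed L] [CharZero L]

open scoped Classical in
theorem card_add_rootMultiplicity_wronskian_le (hW : (wronskian f g).map (residue A) ≠ 0)
    (hf : ∀ t ∈ discRamification f g α, f.IsRoot t)
    (hg : ∀ t ∈ discRamification f g α, ¬g.IsRoot t) :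
    ((wronskian f g).roots.filter fun t => α = residue A t).toFinset.card +
        ((wronskian f g).map (residue A)).rootMultiplicity α ≤
      (f.map (residue A)).rootMultiplicity α := by
  have hf0 : f.map (residue A) ≠ 0 := by
    intro h
    simp [wronskian_map, h] at hW
  rw [rootMultiplicity_map_residue hW, rootMultiplicity_map_residue hf0, Multiset.card_toFinset,
    ← Multiset.card_add]
  refine Multiset.card_le_card (Multiset.le_iff_count.mpr fun t => ?_)
  by_cases ht : t ∈ (wronskian f g).roots.filter fun t => α = residue A t
  · obtain ⟨htW, htα⟩ := Multiset.mem_filter.mp ht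
    have htR : t ∈ discRamification f g α := ⟨htα.symm, isRoot_of_mem_roots htW⟩
    rw [Multiset.count_add, Multiset.count_dedup, if_pos ht, Multiset.count_filter,
      Multiset.count_filter, if_pos htα, if_pos htα, count_roots, count_roots, add_comm,
      rootMultiplicity_wronskian_add_one (fun h => hf0 (by rw [h, Polynomial.map_zero]))
        (hf t htR) (hg t htR)]
  · rw [Multiset.count_eq_zero_of_notMem (by simpa [Multiset.mem_dedup] using ht)]
    exact Nat.zero_le _

theorem discRamification_subsingleton_of_isRoot (hW : (wronskian f g).map (residue A) ≠ 0)
    (hf : ∀ t ∈ discRamification f g α, f.IsRoot t)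
    (hg : ∀ t ∈ discRamification f g α, ¬g.IsRoot t) :
    (discRamification f g α).Subsingleton ∧
      ((discRamification f g α).Nonempty → ¬(g.map (residue A)).IsRoot α) := by
  classical
  have hle := card_add_rootMultiplicity_wronskian_le hW hf hg
  set S := ((wronskian f g).roots.filter fun t => α = residue A t).toFinset
  have hmem : ∀ t ∈ discRamification f g α, t ∈ S := fun t ht => by
    have hW0 : wronskian f g ≠ 0 := fun h => hW (by rw [h, Polynomial.map_zero])
    rw [Multiset.mem_toFinset, Multiset.mem_filter, mem_roots hW0]
    exact ⟨ht.2, ht.1.symm⟩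
  rw [wronskian_map] at hle hW
  constructor
  · have hub := rootMultiplicity_le_wronskian_add_one hW α
    have hcard : S.card ≤ 1 := by omega
    exact fun t ht t' ht' => Finset.card_le_one.mp hcard t (hmem t ht) t' (hmem t' ht')
  · rintro ⟨t, ht⟩ hgα
    have hub := rootMultiplicity_le_wronskian hW hgα
    have hcard : 0 < S.card := Finset.card_pos.mpr ⟨t, hmem t ht⟩
    omega

theorem discRamification_subsingleton_of_dvd (hW : (wronskian f g).map (residue A) ≠ 0)
    (hcop : ∀ t, ¬(f.IsRoot t ∧ g.IsRoot t))
    (hval : ∀ t ∈ discRamification f g α, ∀ t' ∈ discRamification f g α,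
      f.eval t * g.eval t' = f.eval t' * g.eval t)
    {t₀ : A} (ht₀ : t₀ ∈ discRamification f g α) (hdvd : g.eval t₀ ∣ f.eval t₀) :
    (discRamification f g α).Subsingleton ∧ ¬(g.map (residue A)).IsRoot α := by
  obtain ⟨a, ha⟩ := hdvd
  have hg₀ : g.eval t₀ ≠ 0 := fun h => hcop t₀ ⟨by rw [IsRoot, ha, h, zero_mul], h⟩
  have hfa : ∀ t ∈ discRamification f g α, f.eval t = a * g.eval t := fun t ht =>
    mul_right_cancel₀ hg₀ (by rw [hval t ht t₀ ht₀, ha]; ring)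
  have hsame : discRamification (f - C a * g) g α = discRamification f g α := by
    simp only [discRamification, wronskian_sub_C_mul_left]
  obtain ⟨hsub, hroot⟩ := discRamification_subsingleton_of_isRoot (f := f - C a * g) (g := g)
    (α := α) (by rwa [wronskian_sub_C_mul_left])
    (fun t ht => by simp [hfa t (hsame ▸ ht)])
    (fun t ht hgt => hcop t ⟨by rw [IsRoot, hfa t (hsame ▸ ht), hgt.eq_zero, mul_zero], hgt⟩)
  rw [hsame] at hsub hroot
  exact ⟨hsub, hroot ⟨t₀, ht₀⟩⟩

theorem discRamification_subsingleton (hW : (wronskian f g).map (residue A) ≠ 0)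
    (hcop : ∀ t, ¬(f.IsRoot t ∧ g.IsRoot t))
    (hval : ∀ t ∈ discRamification f g α, ∀ t' ∈ discRamification f g α,
      f.eval t * g.eval t' = f.eval t' * g.eval t) :
    (discRamification f g α).Subsingleton ∧
      ¬((f.map (residue A)).IsRoot α ∧ (g.map (residue A)).IsRoot α) := by
  obtain hempty | ⟨t₀, ht₀⟩ := (discRamification f g α).eq_empty_or_nonempty
  · refine ⟨hempty ▸ Set.subsingleton_empty, fun ⟨hf, hg⟩ => ?_⟩
    have hWα : ((wronskian f g).map (residue A)).IsRoot α := by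
      simp [wronskian, hf.eq_zero, hg.eq_zero]
    obtain ⟨t, ht⟩ := exists_isRoot_of_isRoot_map_residue hW hWα
    exact Set.notMem_empty t (hempty ▸ ht)
  · obtain hdvd | hdvd := ValuationRing.dvd_total (f.eval t₀) (g.eval t₀)
    · rw [discRamification_comm] at hval ht₀ ⊢
      have hW' : (wronskian g f).map (residue A) ≠ 0 := by
        rwa [← wronskian_neg_eq, Polynomial.map_neg, neg_ne_zero]
      have hval' : ∀ t ∈ discRamification g f α, ∀ t' ∈ discRamification g f α,
          g.eval t * f.eval t' = g.eval t' * f.eval t := fun t ht t' ht' => by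
        rw [mul_comm, hval t' ht' t ht, mul_comm]
      obtain ⟨hsub, hroot⟩ := discRamification_subsingleton_of_dvd hW'
        (fun t ht => hcop t ht.symm) hval' ht₀ hdvd
      exact ⟨hsub, fun h => hroot h.1⟩
    · obtain ⟨hsub, hroot⟩ := discRamification_subsingleton_of_dvd hW hcop hval ht₀ hdvd
      exact ⟨hsub, fun h => hroot h.2⟩

end ResidueDisc

section Charts

variable {R : Type*} [CommRing R]

/-- Homogeneous coordinates of the point with affine coordinate `x` in the chart of the line on
which the `i`-th coordinate is `1`. -/
def affineVec (i : Fin 2) (x : R) : Fin 2 → R := fun j => if j = i then 1 else x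

/-- Dehomogenization in the `i`-th affine chart. -/
def chart (i : Fin 2) : MvPolynomial (Fin 2) R →ₐ[R] R[X] := MvPolynomial.aeval (affineVec i X)

/-- The linear form that vanishes at the point with homogeneous coordinates `v`. -/
def linForm (v : Fin 2 → R) : MvPolynomial (Fin 2) R :=
  MvPolynomial.C (v 1) * MvPolynomial.X 0 - MvPolynomial.C (v 0) * MvPolynomial.X 1

/-- `[F : G]` is ramified at the point with homogeneous coordinates `v`: the form that cuts out the
fibre through `v` vanishes there to order at least `2`. -/
def IsRam (F G : MvPolynomial (Fin 2) R) (v : Fin 2 → R) : Prop :=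
  linForm v ^ 2 ∣ MvPolynomial.C (MvPolynomial.eval v G) * F -
    MvPolynomial.C (MvPolynomial.eval v F) * G

theorem comp_affineVec {S : Type*} [CommRing S] (ψ : R →+* S) (i : Fin 2) (x : R) :
    ψ ∘ affineVec i x = affineVec i (ψ x) := by
  ext j
  simp [affineVec, apply_ite ψ]

theorem map_chart {S : Type*} [CommRing S] (ψ : R →+* S) (i : Fin 2)
    (F : MvPolynomial (Fin 2) R) : (chart i F).map ψ = chart i (F.map ψ) := by
  have hX : mapRingHom ψ ∘ affineVec i X = affineVec i X := by
    rw [comp_affineVec, coe_mapRingHom, map_X]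
  rw [chart, chart, MvPolynomial.aeval_def, MvPolynomial.aeval_def, MvPolynomial.eval₂_map,
    ← coe_mapRingHom, MvPolynomial.eval₂_comp_left, hX]
  congr 1
  ext a
  simp

theorem eval_chart (i : Fin 2) (F : MvPolynomial (Fin 2) R) (x : R) :
    (chart i F).eval x = MvPolynomial.eval (affineVec i x) F := by
  have hX : evalRingHom x ∘ affineVec i X = affineVec i x := by
    rw [comp_affineVec, coe_evalRingHom, eval_X]
  rw [chart, MvPolynomial.aeval_def, ← coe_evalRingHom, MvPolynomial.eval₂_comp_left, hX]
  rw [MvPolynomial.eval, MvPolynomial.coe_eval₂Hom]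
  congr 1
  ext a
  simp

theorem chart_one_homogenize {f : R[X]} {d : ℕ} (hf : f.natDegree ≤ d) :
    chart 1 (f.homogenize d) = f := by
  rw [chart, Polynomial.aeval_homogenize_of_eq_one hf _ (by simp [affineVec])]
  simp [affineVec]

theorem natDegree_chart_le {d : ℕ} {F : MvPolynomial (Fin 2) R} (hF : F.IsHomogeneous d)
    (i : Fin 2) : (chart i F).natDegree ≤ d := by
  have h := MvPolynomial.aeval_natDegree_le F hF.totalDegree_le (affineVec i (X : R[X])) (n := 1)
    fun j => by
      rw [affineVec]
      split_ifs
      · simp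
      · exact natDegree_X_le
  rwa [mul_one] at h

theorem homogenize_chart_one {d : ℕ} {F : MvPolynomial (Fin 2) R} (hF : F.IsHomogeneous d) :
    (chart 1 F).homogenize d = F := by
  refine Polynomial.homogenize_eq_of_isHomogeneous hF ?_
  rw [chart]
  congr 2
  ext j
  fin_cases j <;> simp [affineVec]

theorem chart_rename_swap (F : MvPolynomial (Fin 2) R) :
    chart 1 (MvPolynomial.rename (Equiv.swap 0 1) F) = chart 0 F := by
  rw [chart, chart, MvPolynomial.aeval_rename]
  congr 2
  ext j
  fin_cases j <;> simp [affineVec]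

theorem homogenize_X_sub_C (x : R) : (X - C x).homogenize 1 = linForm (affineVec 1 x) := by
  rw [Polynomial.homogenize_sub, Polynomial.homogenize_X one_ne_zero, Polynomial.homogenize_C]
  simp [linForm, affineVec]

theorem linForm_pow_dvd_homogenize_iff {f : R[X]} {d : ℕ} (hf : f.natDegree ≤ d) (n : ℕ) (x : R) :
    linForm (affineVec 1 x) ^ n ∣ f.homogenize d ↔ (X - C x) ^ n ∣ f := by
  have hdeg : ((X - C x) ^ n).natDegree ≤ n :=
    natDegree_pow_le_of_le n (natDegree_X_sub_C_le x) |>.trans (mul_one n).le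
  have hpow : ((X - C x) ^ n).homogenize n = linForm (affineVec 1 x) ^ n := by
    simpa only [homogenize_X_sub_C, Finset.prod_const, Finset.card_range, Finset.sum_const,
      smul_eq_mul, mul_one] using Polynomial.homogenize_finsetProd (s := Finset.range n)
      (p := fun _ => X - C x) (n := fun _ => 1) fun _ _ => natDegree_X_sub_C_le x
  constructor
  · intro h
    have hlin : chart 1 (linForm (affineVec 1 x)) = X - C x := by
      rw [← homogenize_X_sub_C, chart_one_homogenize (natDegree_X_sub_C_le x)]
    simpa only [map_pow, hlin, chart_one_homogenize hf] using map_dvd (chart 1) h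
  · rintro ⟨u, rfl⟩
    obtain rfl | hu := eq_or_ne u 0
    · rw [mul_zero, Polynomial.homogenize_zero]
      exact dvd_zero _
    nontriviality R
    rw [((monic_X_sub_C x).pow n).natDegree_mul' hu, (monic_X_sub_C x).natDegree_pow,
      natDegree_X_sub_C, mul_one] at hf
    obtain ⟨m, rfl⟩ := Nat.exists_eq_add_of_le (Nat.le_of_add_right_le hf)
    rw [Polynomial.homogenize_mul _ _ hdeg (by omega), hpow]
    exact dvd_mul_right _ _

theorem linForm_pow_dvd_iff {d : ℕ} {F : MvPolynomial (Fin 2) R} (hF : F.IsHomogeneous d)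
    (i : Fin 2) (n : ℕ) (x : R) :
    linForm (affineVec i x) ^ n ∣ F ↔ (X - C x) ^ n ∣ chart i F := by
  have hone : ∀ {G : MvPolynomial (Fin 2) R}, G.IsHomogeneous d →
      (linForm (affineVec 1 x) ^ n ∣ G ↔ (X - C x) ^ n ∣ chart 1 G) := fun hG => by
    rw [← linForm_pow_dvd_homogenize_iff (natDegree_chart_le hG 1), homogenize_chart_one hG]
  fin_cases i
  · have hlin : MvPolynomial.renameEquiv R (Equiv.swap 0 1) (linForm (affineVec 0 x)) =
        -linForm (affineVec 1 x) := by
      simp [linForm, affineVec]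
    have hswap := hone (G := MvPolynomial.renameEquiv R (Equiv.swap 0 1) F) hF.rename_isHomogeneous
    change linForm (affineVec 0 x) ^ n ∣ F ↔ (X - C x) ^ n ∣ chart 0 F
    rw [← map_dvd_iff (MvPolynomial.renameEquiv R (Equiv.swap 0 1)), map_pow, hlin, neg_pow,
      (isUnit_neg_one.pow n).mul_left_dvd, hswap, MvPolynomial.renameEquiv_apply,
      chart_rename_swap]
  · exact hone hF

theorem eval_smul_of_isHomogeneous {σ : Type*} {d : ℕ} {F : MvPolynomial σ R}
    (hF : F.IsHomogeneous d) (c : R) (v : σ → R) :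
    MvPolynomial.eval (c • v) F = c ^ d * MvPolynomial.eval v F := by
  rw [MvPolynomial.eval_eq, MvPolynomial.eval_eq, Finset.mul_sum]
  refine Finset.sum_congr rfl fun m hm => ?_
  simp only [Pi.smul_apply, smul_eq_mul, mul_pow, Finset.prod_mul_distrib,
    Finset.prod_pow_eq_pow_sum, ← hF.degree_eq_sum_deg_support hm]
  ring

theorem isRam_affineVec_iff {d : ℕ} {F G : MvPolynomial (Fin 2) R} (hF : F.IsHomogeneous d)
    (hG : G.IsHomogeneous d) (i : Fin 2) (x : R) :
    IsRam F G (affineVec i x) ↔ (wronskian (chart i F) (chart i G)).IsRoot x := by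
  have hC : ∀ a : R, chart i (MvPolynomial.C a) = C a := fun a => by simp [chart]
  rw [IsRam, linForm_pow_dvd_iff ((hF.C_mul _).sub (hG.C_mul _)), map_sub, map_mul, map_mul, hC, hC,
    ← eval_chart, ← eval_chart, X_sub_C_sq_dvd_fiber_iff]

theorem isRam_smul {d : ℕ} {F G : MvPolynomial (Fin 2) R} (hF : F.IsHomogeneous d)
    (hG : G.IsHomogeneous d) {c : R} (hc : IsUnit c) (v : Fin 2 → R) :
    IsRam F G (c • v) ↔ IsRam F G v := by
  have hlin : linForm (c • v) = MvPolynomial.C c * linForm v := by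
    simp only [linForm, Pi.smul_apply, smul_eq_mul, map_mul]
    ring
  have hfiber : MvPolynomial.C (MvPolynomial.eval (c • v) G) * F -
      MvPolynomial.C (MvPolynomial.eval (c • v) F) * G = MvPolynomial.C c ^ d *
        (MvPolynomial.C (MvPolynomial.eval v G) * F -
          MvPolynomial.C (MvPolynomial.eval v F) * G) := by
    rw [eval_smul_of_isHomogeneous hF, eval_smul_of_isHomogeneous hG]
    simp only [map_mul, map_pow]
    ring
  rw [IsRam, IsRam, hlin, hfiber, mul_pow, ((hc.map _).pow d).dvd_mul_left,
    ((hc.map _).pow 2).mul_left_dvd]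

theorem isRam_C_mul (F G : MvPolynomial (Fin 2) R) {c : R} (hc : IsUnit c) (v : Fin 2 → R) :
    IsRam (MvPolynomial.C c * F) (MvPolynomial.C c * G) v ↔ IsRam F G v := by
  have hfiber : MvPolynomial.C (MvPolynomial.eval v (MvPolynomial.C c * G)) *
        (MvPolynomial.C c * F) -
      MvPolynomial.C (MvPolynomial.eval v (MvPolynomial.C c * F)) * (MvPolynomial.C c * G) =
        MvPolynomial.C c ^ 2 * (MvPolynomial.C (MvPolynomial.eval v G) * F -
          MvPolynomial.C (MvPolynomial.eval v F) * G) := by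
    simp only [map_mul, MvPolynomial.eval_C]
    ring
  rw [IsRam, IsRam, hfiber, ((hc.map _).pow 2).dvd_mul_left]

end Charts

section ChartsField

variable {k : Type*} [Field k]

theorem affineVec_eq_smul {i j : Fin 2} (hij : i ≠ j) {x y : k} (hxy : x * y = 1) :
    affineVec i x = x • affineVec j y := by
  ext l
  fin_cases i <;> fin_cases j <;> fin_cases l <;> simp_all [affineVec]

theorem wronskian_chart_ne_zero [Infinite k] {d : ℕ} {F G : MvPolynomial (Fin 2) k}
    (hF : F.IsHomogeneous d) (hG : G.IsHomogeneous d) {i : Fin 2}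
    (hW : wronskian (chart i F) (chart i G) ≠ 0) (j : Fin 2) :
    wronskian (chart j F) (chart j G) ≠ 0 := by
  obtain rfl | hij := eq_or_ne i j
  · exact hW
  intro hj
  refine mul_ne_zero X_ne_zero hW (Polynomial.funext fun x => ?_)
  obtain rfl | hx := eq_or_ne x 0
  · simp
  have hroot : (wronskian (chart i F) (chart i G)).IsRoot x := by
    rw [← isRam_affineVec_iff hF hG, affineVec_eq_smul hij (mul_inv_cancel₀ hx),
      isRam_smul hF hG hx.isUnit, isRam_affineVec_iff hF hG, hj]
    exact eval_zero
  rw [eval_mul, hroot.eq_zero, mul_zero, eval_zero]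

end ChartsField

section AffinePoints

variable {k : Type*} [Field k]

theorem exists_eq_smul_affineVec {v : Fin 2 → k} (hv : v ≠ 0) :
    ∃ c : k, c ≠ 0 ∧ ∃ i x, v = c • affineVec i x := by
  obtain ⟨i, hi⟩ := Function.ne_iff.mp hv
  obtain ⟨j, hij⟩ := exists_ne i
  refine ⟨v i, hi, i, v j / v i, ?_⟩
  ext l
  fin_cases i <;> fin_cases j <;> fin_cases l <;> simp_all [affineVec, mul_div_cancel₀]

theorem affineVec_ne_zero (i : Fin 2) (x : k) : affineVec i x ≠ 0 := fun h => by
  simpa [affineVec] using congrFun h i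

/-- The point with coordinate `x` in the `i`-th affine chart. -/
def affinePt (i : Fin 2) (x : k) : Pt k := Projectivization.mk k _ (affineVec_ne_zero i x)

theorem affinePt_injective (i : Fin 2) : Function.Injective (affinePt (k := k) i) := by
  intro x y h
  rw [affinePt, affinePt, Projectivization.mk_eq_mk_iff'] at h
  obtain ⟨c, hc⟩ := h
  obtain ⟨j, hij⟩ := exists_ne i
  have hi : c = 1 := by simpa [affineVec] using congrFun hc i
  simpa [affineVec, hij, hi] using (congrFun hc j).symm

theorem affinePt_eq_affinePt_iff {i j : Fin 2} (hij : i ≠ j) {x y : k} :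
    affinePt i x = affinePt j y ↔ x * y = 1 := by
  rw [affinePt, affinePt, Projectivization.mk_eq_mk_iff']
  refine ⟨?_, fun h => ⟨x, (affineVec_eq_smul hij h).symm⟩⟩
  rintro ⟨c, hc⟩
  have hi := congrFun hc i
  have hj := congrFun hc j
  simp only [affineVec, Pi.smul_apply, smul_eq_mul, if_true, if_neg hij, if_neg hij.symm,
    mul_one] at hi hj
  rw [← hj, hi]

variable {L : Type*} [Field L] {A : ValuationSubring L}

theorem reducePt_affinePt (i : Fin 2) (a : A) :
    reducePt A (affinePt i (a : L)) = affinePt i (residue A a) := by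
  have hunit : ∃ j, IsUnit (affineVec i a j) := ⟨i, by simp [affineVec]⟩
  have hcoe : (fun j => ((affineVec i a j : A) : L)) = affineVec i (a : L) :=
    comp_affineVec A.subtype i a
  have hres : (fun j => residue A (affineVec i a j)) = affineVec i (residue A a) :=
    comp_affineVec (residue A) i a
  simpa only [affinePt, hcoe, hres] using
    reducePt_mk A (affineVec i a) hunit (by rw [hcoe]; exact affineVec_ne_zero i _)

theorem exists_eq_affinePt_coe (A : ValuationSubring L) (P : Pt L) :
    ∃ (i : Fin 2) (a : A), P = affinePt i (a : L) := by
  obtain ⟨c, -, i, x, hv⟩ := exists_eq_smul_affineVec P.rep_nonzero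
  have hP : P = affinePt i x := by
    rw [← P.mk_rep, affinePt, Projectivization.mk_eq_mk_iff']
    exact ⟨c, hv.symm⟩
  by_cases hx : x ∈ A
  · exact ⟨i, ⟨x, hx⟩, hP⟩
  obtain ⟨j, hij⟩ := exists_ne i
  have hx0 : x ≠ 0 := by
    rintro rfl
    exact hx A.zero_mem
  exact ⟨j, ⟨x⁻¹, (A.mem_or_inv_mem x).resolve_left hx⟩,
    hP.trans ((affinePt_eq_affinePt_iff hij.symm).mpr (mul_inv_cancel₀ hx0))⟩

theorem exists_eq_affinePt_of_reducePt_eq {P : Pt L} {i : Fin 2} {α : ResidueField A}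
    (h : reducePt A P = affinePt i α) : ∃ t : A, residue A t = α ∧ P = affinePt i (t : L) := by
  obtain ⟨j, a, rfl⟩ := exists_eq_affinePt_coe A P
  rw [reducePt_affinePt] at h
  obtain rfl | hij := eq_or_ne i j
  · exact ⟨a, affinePt_injective i h, rfl⟩
  rw [affinePt_eq_affinePt_iff hij.symm] at h
  obtain ⟨b, hb⟩ :=
    ((residue_ne_zero_iff_isUnit a).mp (left_ne_zero_of_mul_eq_one h)).exists_right_inv
  refine ⟨b, ?_, (affinePt_eq_affinePt_iff hij.symm).mpr (by exact_mod_cast hb)⟩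
  exact mul_left_cancel₀ (left_ne_zero_of_mul_eq_one h) (by rw [h, ← map_mul, hb, map_one])

end AffinePoints

section Separable

open scoped IntermediateField.algebraAdjoinAdjoin

variable {k : Type*} [Field k]

theorem ne_C_of_isSeparable (φ : RatFunc k) [Algebra.IsSeparable k⟮φ⟯ (RatFunc k)] :
    ¬∃ c, φ = RatFunc.C c := by
  rintro ⟨c, rfl⟩
  have : Algebra.IsAlgebraic k k⟮(RatFunc.C c : RatFunc k)⟯ :=
    IntermediateField.isAlgebraic_adjoin_simple (isIntegral_algebraMap (A := RatFunc k))
  have htr : Algebra.Transcendental k (RatFunc k) := inferInstance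
  exact Algebra.transcendental_iff_not_isAlgebraic.mp htr
    (Algebra.IsAlgebraic.trans k k⟮(RatFunc.C c : RatFunc k)⟯ (RatFunc k))

theorem wronskian_num_denom_ne_zero (φ : RatFunc k) [Algebra.IsSeparable k⟮φ⟯ (RatFunc k)] :
    wronskian φ.num φ.denom ≠ 0 := by
  intro hW
  obtain ⟨hnum, hden⟩ := φ.isCoprime_num_denom.wronskian_eq_zero_iff.mp hW
  have hirr : Irreducible (φ.minpolyX k⟮φ⟯) := φ.irreducible_minpolyX (ne_C_of_isSeparable φ)
  have hsep : (φ.minpolyX k⟮φ⟯).Separable := by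
    have hX := Algebra.IsSeparable.isSeparable k⟮φ⟯ (RatFunc.X : RatFunc k)
    rw [IsSeparable, ← minpoly.eq_of_irreducible hirr φ.minpolyX_aeval_X] at hX
    exact hX.of_mul_left
  refine hirr.not_isUnit (isCoprime_zero_right.mp ?_)
  have hder : derivative (φ.minpolyX k⟮φ⟯) = 0 := by
    simp [derivative_map, hnum, hden]
  rwa [Polynomial.Separable, hder] at hsep

end Separable

section OfPair

variable {k : Type*} [Field k]

theorem exists_eq_mul_num_den {f g : k[X]} (hfg : ¬(f = 0 ∧ g = 0)) :
    ∃ h : k[X], h ≠ 0 ∧ f = h * Mor.num (Mor.ofPair f g) ∧ g = h * Mor.den (Mor.ofPair f g) := by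
  by_cases hg : g = 0
  · refine ⟨f, fun hf => hfg ⟨hf, hg⟩, ?_, ?_⟩ <;> simp [Mor.ofPair, Mor.num, Mor.den, hg]
  rw [Mor.ofPair, if_neg hg]
  set φ : RatFunc k := algebraMap k[X] (RatFunc k) f / algebraMap k[X] (RatFunc k) g with hφ
  change ∃ h : k[X], h ≠ 0 ∧ f = h * φ.num ∧ g = h * φ.denom
  have hcross : φ.num * g = f * φ.denom := (RatFunc.num_mul_eq_mul_denom_iff hg).mpr hφ
  obtain ⟨h, hgh⟩ : φ.denom ∣ g :=
    φ.isCoprime_num_denom.symm.dvd_of_dvd_mul_left (hcross ▸ dvd_mul_left _ _)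
  refine ⟨h, right_ne_zero_of_mul (hgh ▸ hg), ?_, hgh.trans (mul_comm _ _)⟩
  refine mul_right_cancel₀ φ.denom_ne_zero ?_
  rw [← hcross, hgh]
  ring

theorem ne_zero_of_isSeparable_ofPair {f g : k[X]} (hsep : Mor.IsSeparable (Mor.ofPair f g)) :
    g ≠ 0 := by
  rintro rfl
  rw [Mor.ofPair, if_pos rfl] at hsep
  exact hsep

theorem wronskian_ne_zero_of_isSeparable_ofPair {f g : k[X]}
    (hsep : Mor.IsSeparable (Mor.ofPair f g)) : wronskian f g ≠ 0 := by
  have hg := ne_zero_of_isSeparable_ofPair hsep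
  obtain ⟨h, hh, hfh, hgh⟩ := exists_eq_mul_num_den (f := f) fun hfg => hg hfg.2
  have hW : wronskian (Mor.num (Mor.ofPair f g)) (Mor.den (Mor.ofPair f g)) ≠ 0 := by
    rw [Mor.ofPair, if_neg hg] at hsep ⊢
    have : Algebra.IsSeparable
        k⟮algebraMap k[X] (RatFunc k) f / algebraMap k[X] (RatFunc k) g⟯ (RatFunc k) := hsep
    exact wronskian_num_denom_ne_zero _
  have hfactor := wronskian_mul_mul_left h (Mor.num (Mor.ofPair f g)) (Mor.den (Mor.ofPair f g))
  rw [← hfh, ← hgh] at hfactor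
  rw [hfactor]
  exact mul_ne_zero (pow_ne_zero 2 hh) hW

/-- The forms `F` and `G` have no common zero on the line, so that `[F : G]` is defined at every
point. -/
def NoCommonZero (F G : MvPolynomial (Fin 2) k) : Prop :=
  ∀ v : Fin 2 → k, v ≠ 0 → (![MvPolynomial.eval v F, MvPolynomial.eval v G] : Fin 2 → k) ≠ 0

theorem exists_eval_homogenize_eq_zero [IsAlgClosed k] {p : k[X]} {m : ℕ}
    (hp : p.natDegree ≤ m) (hm : m ≠ 0) :
    ∃ v : Fin 2 → k, v ≠ 0 ∧ MvPolynomial.eval v (p.homogenize m) = 0 := by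
  obtain rfl | hlt := hp.eq_or_lt
  · obtain ⟨x, hx⟩ := IsAlgClosed.exists_root p
      fun h0 => hm (natDegree_eq_of_degree_eq_some h0)
    refine ⟨affineVec 1 x, affineVec_ne_zero 1 x, ?_⟩
    rw [← eval_chart, chart_one_homogenize le_rfl]
    exact hx
  · obtain ⟨n, rfl⟩ := Nat.exists_eq_succ_of_ne_zero hm
    refine ⟨affineVec 0 0, affineVec_ne_zero 0 0, ?_⟩
    have hmul := Polynomial.homogenize_mul p 1 (Nat.lt_succ_iff.mp hlt) (n := 1) (by simp)
    rw [mul_one] at hmul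
    rw [Nat.succ_eq_add_one, hmul]
    simp [affineVec]

theorem noCommonZero_homogenize_mul_iff [IsAlgClosed k] {h : k[X]} {m : ℕ} (hh : h ≠ 0)
    (hm : h.natDegree ≤ m) {F G : MvPolynomial (Fin 2) k} (hFG : NoCommonZero F G) :
    NoCommonZero (h.homogenize m * F) (h.homogenize m * G) ↔ m = 0 := by
  refine ⟨fun hno => ?_, ?_⟩
  · by_contra hm0
    obtain ⟨v, hv, hv0⟩ := exists_eval_homogenize_eq_zero hm hm0
    exact hno v hv (by simp [hv0])
  · rintro rfl v hv
    obtain ⟨c, rfl⟩ := natDegree_eq_zero.mp (Nat.le_zero.mp hm)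
    have hc : c ≠ 0 := by simpa using hh
    have hsmul := smul_ne_zero hc (hFG v hv)
    simpa using hsmul

theorem noCommonZero_map_forms {κ : Type*} [Field κ] (ρ : k →+* κ) (Φ : Mor k) :
    NoCommonZero ((Mor.formF Φ).map ρ) ((Mor.formG Φ).map ρ) := by
  intro v hv
  let := ρ.toAlgebra
  rw [MvPolynomial.eval_map, MvPolynomial.eval_map]
  exact Mor.forms_ne_zero Φ v hv

theorem natDegree_add_deg_le {Φ : Mor k} {h : k[X]} (hh : h ≠ 0) {d : ℕ}
    (hf : (h * Mor.num Φ).natDegree ≤ d) (hg : (h * Mor.den Φ).natDegree ≤ d) :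
    h.natDegree + Mor.deg Φ ≤ d := by
  by_cases hnum : Mor.num Φ = 0
  · have hden : Mor.den Φ ≠ 0 :=
      (Mor.isCoprime Φ).ne_zero_or_ne_zero.resolve_left (not_not.mpr hnum)
    rw [natDegree_mul hh hden] at hg
    simpa [Mor.deg, hnum] using hg
  by_cases hden : Mor.den Φ = 0
  · rw [natDegree_mul hh hnum] at hf
    simpa [Mor.deg, hden] using hf
  rw [natDegree_mul hh hnum] at hf
  rw [natDegree_mul hh hden] at hg
  rw [Mor.deg, ← Nat.add_max_add_left]
  exact max_le hf hg

theorem deg_ofPair_eq_iff {κ : Type*} [Field κ] [IsAlgClosed κ] (ρ : k →+* κ) {f g : k[X]} {d : ℕ}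
    (hf : f.natDegree ≤ d) (hg : g.natDegree ≤ d) (hfg : ¬(f = 0 ∧ g = 0)) :
    Mor.deg (Mor.ofPair f g) = d ↔
      NoCommonZero ((f.homogenize d).map ρ) ((g.homogenize d).map ρ) := by
  obtain ⟨h, hh, hfh, hgh⟩ := exists_eq_mul_num_den hfg
  set Ψ := Mor.ofPair f g
  have hle : h.natDegree + Mor.deg Ψ ≤ d := natDegree_add_deg_le hh (hfh ▸ hf) (hgh ▸ hg)
  obtain ⟨m, rfl⟩ := Nat.exists_eq_add_of_le' (Nat.le_of_add_left_le hle)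
  have hm : h.natDegree ≤ m := Nat.le_of_add_le_add_right hle
  have hF : f.homogenize (m + Mor.deg Ψ) = h.homogenize m * Mor.formF Ψ := by
    rw [hfh]
    exact Polynomial.homogenize_mul _ _ hm (le_max_left _ _)
  have hG : g.homogenize (m + Mor.deg Ψ) = h.homogenize m * Mor.formG Ψ := by
    rw [hgh]
    exact Polynomial.homogenize_mul _ _ hm (le_max_right _ _)
  rw [hF, hG, map_mul, map_mul, ← Polynomial.homogenize_map,
    noCommonZero_homogenize_mul_iff ((Polynomial.map_ne_zero_iff ρ.injective).mpr hh)
      (natDegree_map_le.trans hm) (noCommonZero_map_forms ρ Ψ)]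
  exact right_eq_add

end OfPair

section BaseChange

variable {K L : Type*} [Field K] [Field L] [Algebra K L]

theorem one_lt_emultiplicity_iff {α : Type*} [Monoid α] {a b : α} :
    1 < emultiplicity a b ↔ a ^ 2 ∣ b := by
  rw [pow_dvd_iff_le_emultiplicity, ← ENat.add_one_le_iff ENat.one_ne_top, one_add_one_eq_two]
  rfl

theorem mk_mem_ramificationSet_iff (Φ : Mor K) {v : Fin 2 → L} (hv : v ≠ 0) :
    Projectivization.mk L v hv ∈ Mor.ramificationSet L Φ ↔
      IsRam ((Mor.formF Φ).map (algebraMap K L)) ((Mor.formG Φ).map (algebraMap K L)) v := by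
  obtain ⟨c, hc⟩ := Projectivization.exists_smul_eq_mk_rep L v hv
  have hF : ((Mor.formF Φ).map (algebraMap K L)).IsHomogeneous (Mor.deg Φ) :=
    (Polynomial.isHomogeneous_homogenize _).map _
  have hG : ((Mor.formG Φ).map (algebraMap K L)).IsHomogeneous (Mor.deg Φ) :=
    (Polynomial.isHomogeneous_homogenize _).map _
  rw [← isRam_smul hF hG c.isUnit v, ← Units.smul_def, hc,
    Mor.ramificationSet, Set.mem_ofPred_eq, Mor.ramificationIdx, IsRam, one_lt_emultiplicity_iff,
    MvPolynomial.eval_map, MvPolynomial.eval_map, ← MvPolynomial.aeval_def,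
    ← MvPolynomial.aeval_def, linForm]

theorem map_mk (Φ : Mor K) {v : Fin 2 → L} (hv : v ≠ 0) :
    Mor.map Φ (Projectivization.mk L v hv) =
      Projectivization.mk L _ (Mor.forms_ne_zero Φ v hv) := by
  obtain ⟨c, hc⟩ := Projectivization.exists_smul_eq_mk_rep L v hv
  have hform : ∀ f : K[X], MvPolynomial.aeval (Projectivization.mk L v hv).rep
      (f.homogenize (Mor.deg Φ)) =
        (c : L) ^ Mor.deg Φ * MvPolynomial.aeval v (f.homogenize (Mor.deg Φ)) := by
    intro f
    rw [← hc, Units.smul_def, MvPolynomial.aeval_def, MvPolynomial.aeval_def,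
      ← MvPolynomial.eval_map, ← MvPolynomial.eval_map]
    exact eval_smul_of_isHomogeneous ((Polynomial.isHomogeneous_homogenize _).map _) _ _
  rw [Mor.map, Projectivization.mk_eq_mk_iff']
  refine ⟨(c : L) ^ Mor.deg Φ, ?_⟩
  rw [Mor.formF, Mor.formG, hform, hform]
  simp

end BaseChange

section Model

variable {K L : Type*} [Field K] [Field L] [Algebra K L] {A : ValuationSubring L} {Φ : Mor K}
  {F G : MvPolynomial (Fin 2) A}

/-- `[F : G]` is an integral model of `Φ`: forms with coefficients in the valuation ring `A` that
are proportional to the forms of `Φ` in lowest terms. -/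
def IsModel (Φ : Mor K) (F G : MvPolynomial (Fin 2) A) : Prop :=
  ∃ c : L, c ≠ 0 ∧
    F.map (algebraMap A L) = MvPolynomial.C c * (Mor.formF Φ).map (algebraMap K L) ∧
    G.map (algebraMap A L) = MvPolynomial.C c * (Mor.formG Φ).map (algebraMap K L)

theorem IsModel.isHomogeneous (h : IsModel Φ F G) :
    F.IsHomogeneous (Mor.deg Φ) ∧ G.IsHomogeneous (Mor.deg Φ) := by
  obtain ⟨c, -, hF, hG⟩ := h
  have hdescend : ∀ (H : MvPolynomial (Fin 2) A) (f : K[X]), H.map (algebraMap A L) =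
      MvPolynomial.C c * (f.homogenize (Mor.deg Φ)).map (algebraMap K L) →
      H.IsHomogeneous (Mor.deg Φ) := by
    intro H f hH m hm
    have hmap : (H.map (algebraMap A L)).IsHomogeneous (Mor.deg Φ) :=
      hH ▸ ((Polynomial.isHomogeneous_homogenize _).map _).C_mul c
    refine hmap ?_
    rwa [MvPolynomial.coeff_map, map_ne_zero_iff _ (FaithfulSMul.algebraMap_injective A L)]
  exact ⟨hdescend F _ hF, hdescend G _ hG⟩

theorem IsModel.affinePt_mem_ramificationSet_iff (h : IsModel Φ F G) (i : Fin 2) (t : A) :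
    affinePt i (t : L) ∈ Mor.ramificationSet L Φ ↔
      (wronskian (chart i F) (chart i G)).IsRoot t := by
  obtain ⟨hFh, hGh⟩ := h.isHomogeneous
  obtain ⟨c, hc, hF, hG⟩ := h
  rw [affinePt, mk_mem_ramificationSet_iff, ← isRam_C_mul _ _ hc.isUnit, ← hF, ← hG,
    isRam_affineVec_iff (hFh.map _) (hGh.map _), ← map_chart, ← map_chart,
    ← wronskian_map]
  exact isRoot_map_iff Subtype.val_injective

theorem IsModel.map_affinePt (h : IsModel Φ F G) (i : Fin 2) (t : A) :
    ∃ hne, Mor.map Φ (affinePt i (t : L)) = Projectivization.mk L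
      (fun j => ((![(chart i F).eval t, (chart i G).eval t] j : A) : L)) hne := by
  obtain ⟨c, hc, hF, hG⟩ := h
  have hcoe : ∀ (H : MvPolynomial (Fin 2) A) (f : MvPolynomial (Fin 2) K),
      H.map (algebraMap A L) = MvPolynomial.C c * f.map (algebraMap K L) →
      (((chart i H).eval t : A) : L) = c * MvPolynomial.aeval (affineVec i (t : L)) f := by
    intro H f hH
    change algebraMap A L _ = _
    rw [← eval₂_at_apply, ← eval_map, map_chart, hH, eval_chart, map_mul, MvPolynomial.eval_C,
      MvPolynomial.eval_map]
    rfl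
  have hvec : (fun j => ((![(chart i F).eval t, (chart i G).eval t] j : A) : L)) =
      c • ![MvPolynomial.aeval (affineVec i (t : L)) (Mor.formF Φ),
        MvPolynomial.aeval (affineVec i (t : L)) (Mor.formG Φ)] := by
    ext j
    fin_cases j
    exacts [hcoe F _ hF, hcoe G _ hG]
  refine ⟨?_, ?_⟩
  · rw [hvec]
    exact smul_ne_zero hc (Mor.forms_ne_zero Φ _ (affineVec_ne_zero i _))
  · rw [affinePt, map_mk, eq_comm, Projectivization.mk_eq_mk_iff']
    exact ⟨c, hvec.symm⟩

theorem IsModel.not_isRoot_chart (h : IsModel Φ F G) (i : Fin 2) (t : A) :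
    ¬((chart i F).IsRoot t ∧ (chart i G).IsRoot t) := by
  rintro ⟨hF, hG⟩
  obtain ⟨hne, -⟩ := h.map_affinePt i t
  refine hne (funext fun j => ?_)
  fin_cases j <;> simp [hF.eq_zero, hG.eq_zero]

theorem IsModel.eval_mul_eval_eq (h : IsModel Φ F G) {i : Fin 2} {t t' : A}
    (ht : Mor.map Φ (affinePt i (t : L)) = Mor.map Φ (affinePt i (t' : L))) :
    (chart i F).eval t * (chart i G).eval t' = (chart i F).eval t' * (chart i G).eval t := by
  obtain ⟨hne, hmap⟩ := h.map_affinePt i t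
  obtain ⟨hne', hmap'⟩ := h.map_affinePt i t'
  rw [hmap, hmap', Projectivization.mk_eq_mk_iff'] at ht
  obtain ⟨c, hc⟩ := ht
  have hF := congrFun hc 0
  have hG := congrFun hc 1
  simp only [Pi.smul_apply, smul_eq_mul, Matrix.cons_val_zero, Matrix.cons_val_one] at hF hG
  apply Subtype.val_injective
  push_cast
  rw [← hF, ← hG]
  ring

theorem IsModel.reducePt_map_affinePt (h : IsModel Φ F G)
    (hgood : NoCommonZero (F.map (residue A)) (G.map (residue A))) (i : Fin 2) (t : A) :
    reducePt A (Mor.map Φ (affinePt i (t : L))) =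
      Projectivization.mk _ _ (hgood _ (affineVec_ne_zero i (residue A t))) := by
  have hres : (fun j => residue A (![(chart i F).eval t, (chart i G).eval t] j)) =
      ![MvPolynomial.eval (affineVec i (residue A t)) (F.map (residue A)),
        MvPolynomial.eval (affineVec i (residue A t)) (G.map (residue A))] := by
    have hform : ∀ H : MvPolynomial (Fin 2) A, residue A ((chart i H).eval t) =
        MvPolynomial.eval (affineVec i (residue A t)) (H.map (residue A)) := fun H => by
      rw [← eval_chart, ← map_chart, eval_map_apply]
    ext j
    fin_cases j
    exacts [hform F, hform G]
  have hunit : ∃ j, IsUnit (![(chart i F).eval t, (chart i G).eval t] j) := by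
    obtain ⟨j, hj⟩ := Function.ne_iff.mp (hgood _ (affineVec_ne_zero i (residue A t)))
    rw [← hres] at hj
    exact ⟨j, (residue_ne_zero_iff_isUnit _).mp hj⟩
  obtain ⟨hne, hmap⟩ := h.map_affinePt i t
  rw [hmap, reducePt_mk A _ hunit hne]
  congr 1

theorem IsModel.reducePt_map_eq (h : IsModel Φ F G)
    (hgood : NoCommonZero (F.map (residue A)) (G.map (residue A))) {P Q : Pt L}
    (hPQ : reducePt A P = reducePt A Q) :
    reducePt A (Mor.map Φ P) = reducePt A (Mor.map Φ Q) := by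
  obtain ⟨i, a, rfl⟩ := exists_eq_affinePt_coe A Q
  rw [reducePt_affinePt] at hPQ
  obtain ⟨b, hb, rfl⟩ := exists_eq_affinePt_of_reducePt_eq hPQ
  rw [h.reducePt_map_affinePt hgood, h.reducePt_map_affinePt hgood]
  simp only [hb]

end Model

section SeparableModel

variable {K L : Type*} [Field K] [Field L] [Algebra K L] {A : ValuationSubring L} {Φ : Mor K}
  {F G : MvPolynomial (Fin 2) A}

theorem IsModel.finite_ramificationSet (h : IsModel Φ F G)
    (hW : ∀ i, wronskian (chart i (F.map (residue A))) (chart i (G.map (residue A))) ≠ 0) :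
    (Mor.ramificationSet L Φ).Finite := by
  have hroots : ∀ i, {t | (wronskian (chart i F) (chart i G)).IsRoot t}.Finite := fun i =>
    finite_setOfPred_isRoot fun h0 => hW i <| by
      rw [← map_chart, ← map_chart, ← wronskian_map, h0, Polynomial.map_zero]
  have hcover : Mor.ramificationSet L Φ ⊆ ⋃ i, (fun t : A => affinePt i (t : L)) ''
      {t | (wronskian (chart i F) (chart i G)).IsRoot t} := fun P hP => by
    obtain ⟨i, t, rfl⟩ := exists_eq_affinePt_coe A P
    exact Set.mem_iUnion.mpr ⟨i, t, (h.affinePt_mem_ramificationSet_iff i t).mp hP, rfl⟩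
  exact (Set.finite_iUnion fun i => (hroots i).image _).subset hcover

theorem nonsingularMod_iff_injOn {E : Set (Pt L)} (hE : E.Finite) :
    NonsingularMod A E ↔ Set.InjOn (reducePt A) E :=
  ⟨fun h => hE.injOn_of_encard_image_eq h.symm, fun h => h.encard_image.symm⟩

variable [IsAlgClosed L] [CharZero L]

theorem IsModel.subsingleton_residueDisc (h : IsModel Φ F G)
    (hW : ∀ i, wronskian (chart i (F.map (residue A))) (chart i (G.map (residue A))) ≠ 0)
    {i : Fin 2} {α : ResidueField A}
    (hval : ∀ P ∈ Mor.ramificationSet L Φ, ∀ Q ∈ Mor.ramificationSet L Φ,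
      reducePt A P = affinePt i α → reducePt A Q = affinePt i α → Mor.map Φ P = Mor.map Φ Q) :
    (Mor.ramificationSet L Φ ∩ reducePt A ⁻¹' {affinePt i α}).Subsingleton ∧
      ¬(MvPolynomial.eval (affineVec i α) (F.map (residue A)) = 0 ∧
        MvPolynomial.eval (affineVec i α) (G.map (residue A)) = 0) := by
  have hmem : ∀ t ∈ discRamification (chart i F) (chart i G) α,
      affinePt i (t : L) ∈ Mor.ramificationSet L Φ ∧
        reducePt A (affinePt i (t : L)) = affinePt i α := fun t ht =>
    ⟨(h.affinePt_mem_ramificationSet_iff i t).mpr ht.2, by rw [reducePt_affinePt, ht.1]⟩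
  obtain ⟨hsub, hroot⟩ := discRamification_subsingleton (f := chart i F) (g := chart i G) (α := α)
    (by rw [wronskian_map, map_chart, map_chart]; exact hW i) (h.not_isRoot_chart i)
    fun t ht t' ht' => h.eval_mul_eval_eq
      (hval _ (hmem t ht).1 _ (hmem t' ht').1 (hmem t ht).2 (hmem t' ht').2)
  rw [map_chart, map_chart, IsRoot, IsRoot, eval_chart, eval_chart] at hroot
  refine ⟨?_, hroot⟩
  rintro P ⟨hP, hPα⟩ Q ⟨hQ, hQα⟩
  obtain ⟨t, ht, rfl⟩ := exists_eq_affinePt_of_reducePt_eq hPα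
  obtain ⟨t', ht', rfl⟩ := exists_eq_affinePt_of_reducePt_eq hQα
  rw [h.affinePt_mem_ramificationSet_iff] at hP hQ
  rw [hsub ⟨ht, hP⟩ ⟨ht', hQ⟩]

theorem IsModel.noCommonZero_of_injOn (h : IsModel Φ F G)
    (hW : ∀ i, wronskian (chart i (F.map (residue A))) (chart i (G.map (residue A))) ≠ 0)
    (hinj : Set.InjOn (reducePt A) (Mor.ramificationSet L Φ)) :
    NoCommonZero (F.map (residue A)) (G.map (residue A)) := by
  intro v hv h0
  obtain ⟨c, hc, i, α, rfl⟩ := exists_eq_smul_affineVec hv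
  have hF := congrFun h0 0
  have hG := congrFun h0 1
  simp only [Matrix.cons_val_zero, Matrix.cons_val_one, Pi.zero_apply,
    eval_smul_of_isHomogeneous (h.isHomogeneous.1.map _),
    eval_smul_of_isHomogeneous (h.isHomogeneous.2.map _), mul_eq_zero, pow_ne_zero _ hc,
    false_or] at hF hG
  refine (h.subsingleton_residueDisc hW (i := i) (α := α) fun P hP Q hQ hPα hQα => ?_).2 ⟨hF, hG⟩
  rw [hinj hP hQ (hPα.trans hQα.symm)]

theorem IsModel.injOn_of_noCommonZero (h : IsModel Φ F G)
    (hW : ∀ i, wronskian (chart i (F.map (residue A))) (chart i (G.map (residue A))) ≠ 0)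
    (hgood : NoCommonZero (F.map (residue A)) (G.map (residue A)))
    (hinj : Set.InjOn (reducePt A) (Mor.branchSet L Φ)) :
    Set.InjOn (reducePt A) (Mor.ramificationSet L Φ) := by
  intro P hP Q hQ hPQ
  obtain ⟨i, a, rfl⟩ := exists_eq_affinePt_coe A Q
  have hQα := reducePt_affinePt i a
  refine (h.subsingleton_residueDisc hW fun P' hP' Q' hQ' hP'α hQ'α => ?_).1
    ⟨hP, hPQ.trans hQα⟩ ⟨hQ, hQα⟩
  exact hinj (Set.mem_image_of_mem _ hP') (Set.mem_image_of_mem _ hQ')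
    (h.reducePt_map_eq hgood (hP'α.trans hQ'α.symm))

theorem IsModel.criticallyGoodReduction_iff (h : IsModel Φ F G)
    (hW : ∀ i, wronskian (chart i (F.map (residue A))) (chart i (G.map (residue A))) ≠ 0) :
    Mor.CriticallyGoodReduction A Φ ↔
      NoCommonZero (F.map (residue A)) (G.map (residue A)) ∧
        NonsingularMod A (Mor.branchSet L Φ) := by
  have hfin := h.finite_ramificationSet hW
  rw [Mor.CriticallyGoodReduction, nonsingularMod_iff_injOn hfin,
    nonsingularMod_iff_injOn (E := Mor.branchSet L Φ) (hfin.image _)]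
  exact ⟨fun ⟨hram, hbr⟩ => ⟨h.noCommonZero_of_injOn hW hram, hbr⟩,
    fun ⟨hgood, hbr⟩ => ⟨h.injOn_of_noCommonZero hW hgood hbr, hbr⟩⟩

end SeparableModel

section ReducedForm

variable {K L : Type*} [Field K] [Field L] [Algebra K L] (w : ValuationSubring L)

/-- The inclusion of the valuation ring that `w` induces on a subfield. -/
def comapInclusion : w.comap (algebraMap K L) →+* w :=
  (algebraMap K L).restrict (w.comap (algebraMap K L)) w fun _ hx => hx

instance isLocalHom_comapInclusion : IsLocalHom (comapInclusion (K := K) w) where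
  map_nonunit x hx := by
    have hval : w.valuation (algebraMap K L x) = 1 := (w.valuation_eq_one_iff _).mp hx
    have hx0 : (x : K) ≠ 0 := by
      rintro h0
      simp [h0] at hval
    have hinv : (x : K)⁻¹ ∈ w.comap (algebraMap K L) := by
      rw [ValuationSubring.mem_comap, map_inv₀, ← w.valuation_le_one_iff, map_inv₀, hval, inv_one]
    exact IsUnit.of_mul_eq_one ⟨(x : K)⁻¹, hinv⟩ (Subtype.ext (mul_inv_cancel₀ hx0))

variable {w}

theorem IsReducedForm.natDegree_le {O : ValuationSubring K} {Φ : Mor K} {f g : O[X]}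
    (h : IsReducedForm O Φ f g) : f.natDegree ≤ Mor.deg Φ ∧ g.natDegree ≤ Mor.deg Φ := by
  obtain ⟨c, hc, hf, hg⟩ := h.exists_scalar
  have hinj := FaithfulSMul.algebraMap_injective O K
  rw [← natDegree_map_eq_of_injective hinj f, ← natDegree_map_eq_of_injective hinj g, hf, hg,
    natDegree_C_mul hc, natDegree_C_mul hc]
  exact ⟨le_max_left _ _, le_max_right _ _⟩

theorem map_residue_map_comapInclusion (f : (w.comap (algebraMap K L))[X]) (d : ℕ) :
    ((f.homogenize d).map (comapInclusion w)).map (residue w) =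
      ((f.map (residue _)).homogenize d).map (ResidueField.map (comapInclusion w)) := by
  rw [Polynomial.homogenize_map, MvPolynomial.map_map, MvPolynomial.map_map]
  rfl

variable {Φ : Mor K} {f g : (w.comap (algebraMap K L))[X]}

theorem IsReducedForm.isModel (h : IsReducedForm (w.comap (algebraMap K L)) Φ f g) :
    IsModel Φ ((f.homogenize (Mor.deg Φ)).map (comapInclusion w))
      ((g.homogenize (Mor.deg Φ)).map (comapInclusion w)) := by
  obtain ⟨c, hc, hf, hg⟩ := h.exists_scalar
  have hform : ∀ (p : (w.comap (algebraMap K L))[X]) (q : K[X]),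
      p.map (algebraMap _ K) = C c * q →
        ((p.homogenize (Mor.deg Φ)).map (comapInclusion w)).map (algebraMap w L) =
          MvPolynomial.C (algebraMap K L c) *
            (q.homogenize (Mor.deg Φ)).map (algebraMap K L) := by
    intro p q hpq
    have hcomp : (algebraMap w L).comp (comapInclusion w) =
        (algebraMap K L).comp (algebraMap (w.comap (algebraMap K L)) K) := rfl
    rw [MvPolynomial.map_map, hcomp, ← MvPolynomial.map_map, ← Polynomial.homogenize_map, hpq,
      Polynomial.homogenize_C_mul, map_mul, MvPolynomial.map_C]
  exact ⟨algebraMap K L c, (_root_.map_ne_zero _).mpr hc, hform f _ hf, hform g _ hg⟩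

theorem IsReducedForm.wronskian_chart_ne_zero [IsAlgClosed L]
    (h : IsReducedForm (w.comap (algebraMap K L)) Φ f g)
    (hsep : Mor.IsSeparable (Mor.ofPair (f.map (residue _)) (g.map (residue _)))) (i : Fin 2) :
    wronskian (chart i (((f.homogenize (Mor.deg Φ)).map (comapInclusion w)).map (residue w)))
      (chart i (((g.homogenize (Mor.deg Φ)).map (comapInclusion w)).map (residue w))) ≠ 0 := by
  have : Infinite (ResidueField w) := IsAlgClosed.instInfinite
  have hhom := h.isModel.isHomogeneous
  refine ProjLine.wronskian_chart_ne_zero (hhom.1.map _) (hhom.2.map _) (i := 1) ?_ i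
  rw [map_residue_map_comapInclusion, map_residue_map_comapInclusion, ← map_chart, ← map_chart,
    chart_one_homogenize (natDegree_map_le.trans h.natDegree_le.1),
    chart_one_homogenize (natDegree_map_le.trans h.natDegree_le.2), ← wronskian_map]
  exact (Polynomial.map_ne_zero_iff (RingHom.injective _)).mpr
    (wronskian_ne_zero_of_isSeparable_ofPair hsep)

theorem IsReducedForm.map_residue_ne_zero {O : ValuationSubring K} {Φ : Mor K} {f g : O[X]}
    (h : IsReducedForm O Φ f g) : ¬(f.map (residue O) = 0 ∧ g.map (residue O) = 0) := by
  have hcoeff : ∀ {p : O[X]} {i : ℕ}, IsUnit (p.coeff i) → p.map (residue O) ≠ 0 :=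
    fun {p i} hu h0 => (residue_ne_zero_iff_isUnit _).mpr hu <| by
      rw [← coeff_map, h0, coeff_zero]
  rintro ⟨hf, hg⟩
  obtain ⟨i, hu | hu⟩ := h.primitive
  exacts [hcoeff hu hf, hcoeff hu hg]

theorem IsReducedForm.deg_ofPair_eq_iff [IsAlgClosed L]
    (h : IsReducedForm (w.comap (algebraMap K L)) Φ f g) :
    Mor.deg (Mor.ofPair (f.map (residue _)) (g.map (residue _))) = Mor.deg Φ ↔
      NoCommonZero (((f.homogenize (Mor.deg Φ)).map (comapInclusion w)).map (residue w))
        (((g.homogenize (Mor.deg Φ)).map (comapInclusion w)).map (residue w)) := by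
  rw [map_residue_map_comapInclusion, map_residue_map_comapInclusion]
  exact ProjLine.deg_ofPair_eq_iff _ (natDegree_map_le.trans h.natDegree_le.1)
    (natDegree_map_le.trans h.natDegree_le.2) h.map_residue_ne_zero

end ReducedForm

end ProjLine

end

theorem mainTheorem1_general {K L : Type*} [Field K] [Field L] [IsAlgClosed L] [CharZero L]
    [Algebra K L] (w : ValuationSubring L) (Φ : ProjLine.Mor K)
    (hsep : ProjLine.Mor.IsSeparable (ProjLine.Mor.reduce (w.comap (algebraMap K L)) Φ)) :
    ProjLine.Mor.CriticallyGoodReduction w Φ ↔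
      (ProjLine.Mor.SimpleGoodReduction (w.comap (algebraMap K L)) Φ ∧
        ProjLine.NonsingularMod w (ProjLine.Mor.branchSet L Φ)) := by
  have hred := (ProjLine.exists_isReducedForm (w.comap (algebraMap K L)) Φ).choose_spec
  rw [hred.isModel.criticallyGoodReduction_iff (hred.wronskian_chart_ne_zero hsep),
    ← hred.deg_ofPair_eq_iff]
  rfl

theorem mainTheorem1 {K : Type*} [Field K] [NumberField K]
    {Kbar : Type*} [Field Kbar] [Algebra K Kbar] [IsAlgClosure K Kbar]
    (v : IsDedekindDomain.HeightOneSpectrum (NumberField.RingOfIntegers K))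
    (w : ValuationSubring Kbar) (hw : w.comap (algebraMap K Kbar) = ProjLine.valuationRing v)
    (Φ : ProjLine.Mor K) (hdeg : 2 ≤ ProjLine.Mor.deg Φ)
    (hsep : ProjLine.Mor.IsSeparable (ProjLine.Mor.reduce (ProjLine.valuationRing v) Φ)) :
    ProjLine.Mor.CriticallyGoodReduction w Φ ↔
      (ProjLine.Mor.SimpleGoodReduction (ProjLine.valuationRing v) Φ ∧
        ProjLine.NonsingularMod w (ProjLine.Mor.branchSet Kbar Φ)) := by
  have : IsAlgClosed Kbar := IsAlgClosure.isAlgClosed K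
  have : CharZero Kbar := charZero_of_injective_algebraMap (algebraMap K Kbar).injective
  rw [← hw] at hsep ⊢
  exact mainTheorem1_general w Φ hsep
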